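/- \textbf{Continuous modular Welch bounds.} Let $\mathcal{A}\neq 0$ be a commutative unital C*-algebra that is either a $\sigma$-finite W*-algebra (every set of mutually orthogonal projections in $\mathcal{A}$ is countable) or an AW*-algebra (every set of mutually orthogonal projections has a supremum among the projections, and every maximal commutative self-adjoint subalgebra is generated, as a closed subalgebra, by its projections). Let $\mathcal{E}$ be a Hilbert C*-module over $\mathcal{A}$ of rank $d$, i.e. a free $\mathcal{A}$-module with a basis of $d$ elements, complete in the norm $\|x\|=\|\langle x,x\rangle\|^{1/2}$; the $\mathcal{A}$-valued inner product is $\mathcal{A}$-linear in the first variable. Let $G$ be a (real, finite-dimensional, Hausdorff) Lie group with left Haar measure $\mu_G$, and let $\{\tau_g\}_{g\in G}\subset\mathcal{E}$ be a continuous modular Bessel family: for each $x\in\mathcal{E}$ the map $G\ni g\mapsto\langle x,\tau_g\rangle\in\mathcal{A}$ is norm continuous, and there is a real $b>0$ such that for all $x\in\mathcal{E}$ the function $g\mapsto\langle x,\tau_g\rangle\langle\tau_g,x\rangle$ is (Bochner) integrable and $$\int_G\langle x,\tau_g\rangle\langle\tau_g,x\rangle\,d\mu_G(g)\le b\,\langle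 x,x\rangle .$$ Assume $\langle\tau_g,\tau_g\rangle=1$ for all $g\in G$. Then $\mu_G(G)<\infty$, and for every integer $m\ge 0$ the functions $(g,h)\mapsto\|\langle\tau_g,\tau_h\rangle\|^{2m}$ and $(g,h)\mapsto\langle\tau_g,\tau_h\rangle^m\langle\tau_h,\tau_g\rangle^m$ are integrable on $G\times G$, and, in the order of $\mathcal{A}$ (real numbers being identified with multiples of $1\in\mathcal{A}$), \begin{align*} \int_{G\times G}\|\langle\tau_g,\tau_h\rangle\|^{2m}\,d(\mu_G\times\mu_G)(g,h)&=\int_G\int_G\|\langle\tau_g,\tau_h\rangle\|^{2m}\,d\mu_G(g)\,d\mu_G(h)\\ &\ge\int_{G\times G}\langle\tau_g,\tau_h\rangle^m\langle\tau_h,\tau_g\rangle^m\,d(\mu_G\times\mu_G)(g,h)\\ &=\int_G\int_G\langle\tau_g,\tau_h\rangle^m\langle\tau_h,\tau_g\rangle^m\,d\mu_G(g)\,d\mu_G(h)\ \ge\ \frac{\mu_G(G)^2}{\binom{d+m-1}{m}} . \end{align*} In particular, for $m=1$, \begin{align*} \int_{G\times G}\|\langle\tau_g,\tau_h\rangle\|^{2}\,d(\mu_G\times\mu_G)(g,h)&=\int_G\int_G\|\langle\tau_g,\tau_h\rangle\|^{2}\,d\mu_G(g)\,d\mu_G(h)\\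 &\ge\int_{G\times G}\langle\tau_g,\tau_h\rangle\langle\tau_h,\tau_g\rangle\,d(\mu_G\times\mu_G)(g,h)\\ &=\int_G\int_G\langle\tau_g,\tau_h\rangle\langle\tau_h,\tau_g\rangle\,d\mu_G(g)\,d\mu_G(h)\ \ge\ \frac{\mu_G(G)^2}{d} . \end{align*} Further, if the diagonal $\Delta=\{(g,g):g\in G\}$ is measurable in $G\times G$ and $(\mu_G\times\mu_G)((G\times G)\setminus\Delta)\neq 0$, then for every integer $m\ge 0$ the supremum below is finite and $$\sup_{g,h\in G,\ g\ne h}\|\langle\tau_g,\tau_h\rangle\|^{2m}\ \ge\ \frac{1}{(\mu_G\times\mu_G)((G\times G)\setminus\Delta)}\left[\frac{\mu_G(G)^2}{\binom{d+m-1}{m}}-(\mu_G\times\mu_G)(\Delta)\right],$$ and in particular $$\sup_{g,h\in G,\ g\ne h}\|\langle\tau_g,\tau_h\rangle\|^{2}\ \ge\ \frac{1}{(\mu_G\times\mu_G)((G\times G)\setminus\Delta)}\left[\frac{\mu_G(G)^2}{d}-(\mu_G\times\mu_G)(\Delta)\right].$$ -/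

import Mathlib

open MeasureTheory
open scoped Manifold ContDiff

/-- A C⋆-algebra is *σ-finite* if every set of mutually orthogonal projections in it is
countable. -/
def IsSigmaFiniteCStar (A : Type*) [CStarAlgebra A] : Prop :=
  ∀ S : Set A, (∀ p ∈ S, IsStarProjection p) → S.Pairwise (fun p q => p * q = 0) → S.Countable

/-- An *AW⋆-algebra* (Kaplansky): a C⋆-algebra in which every set of mutually orthogonal
projections has a supremum (in the ordered set of projections), and in which every maximal
commutative self-adjoint subalgebra is generated, as a closed subalgebra, by its projections. -/
structure IsAWStarAlgebra (A : Type*) [CStarAlgebra A] [PartialOrder A] [StarOrderedRing A] :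
    Prop where
  exists_sup : ∀ S : Set A, (∀ p ∈ S, IsStarProjection p) →
    S.Pairwise (fun p q => p * q = 0) →
    ∃ s : A, IsStarProjection s ∧ (∀ p ∈ S, p ≤ s) ∧
      ∀ q : A, IsStarProjection q → (∀ p ∈ S, p ≤ q) → s ≤ q
  generated : ∀ B : StarSubalgebra ℂ A,
    Maximal (fun C : StarSubalgebra ℂ A => ∀ x ∈ C, ∀ y ∈ C, x * y = y * x) B →
    (StarAlgebra.adjoin ℂ {p : A | p ∈ B ∧ IsStarProjection p}).topologicalClosure = B

/-- `τ : G → E` is a *continuous modular Bessel family* for the Hilbert C⋆-module `E` over `A`,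
with respect to the measure `μ` on `G`: `g ↦ ⟨x, τ g⟩` is norm continuous for every `x`, and there
is a real `b > 0` such that `∫ ⟨x, τ g⟩ ⟨τ g, x⟩ dμ(g)` exists and is at most `b ⟨x, x⟩` for
every `x`.

Mathlib's `inner A y x` is linear in its last argument, so `inner A y x` is the inner product
`⟨x, y⟩` that is linear in the first variable. -/
structure IsContinuousModularBessel (A : Type*) {E G : Type*} [CommCStarAlgebra A]
    [PartialOrder A] [StarOrderedRing A] [NormedAddCommGroup E] [Module ℂ E] [Module A E]
    [CStarModule A E] [TopologicalSpace G] [MeasurableSpace G] (μ : Measure G) (τ : G → E) :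
    Prop where
  continuous_inner : ∀ x : E, Continuous fun g => inner A (τ g) x
  bessel : ∃ b : ℝ, 0 < b ∧ ∀ x : E,
    Integrable (fun g => inner A (τ g) x * inner A x (τ g)) μ ∧
    ∫ g, inner A (τ g) x * inner A x (τ g) ∂μ ≤ b • inner A x x

/-!
An inequality in a commutative C⋆-algebra `A` holds as soon as it holds after applying every
character `χ` (`le_iff_forall_character_le`), and characters commute with Bochner integrals. Applying
`χ` to the inner product of a module of rank `d` gives a positive semidefinite scalar form, which is
the pullback of the inner product of `ℂ^d` under an additive map (`exists_character_realization`).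
So the vectors `τ g` become unit vectors in `ℂ^d`, and the Welch bound for these is what has to be
proved.

The scalar bound (`measureReal_sq_le_integral_norm_inner_pow`) comes from symmetric tensor powers. The
multinomial theorem writes `⟨x, y⟩ ^ m` as an inner product of vectors with `(d + m - 1).choose m`
coordinates, one for each multiset of size `m`. The double integral of `|⟨x, y⟩| ^ (2 m)` is then the
squared Hilbert–Schmidt norm of the matrix of integrals of products of coordinates. The trace of this
matrix is the mass of `μ`, and the Cauchy–Schwarz inequality bounds its square by the size of the
matrix times the squared norm (`sq_integral_sum_norm_sq_le`).

The measure is finite because, at any character, `⟨τ g, τ g⟩ = 1` is a finite sum of functions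
`⟨u, τ g⟩ ⟨τ g, u⟩`, which are integrable by hypothesis (`IsContinuousModularBessel.isFiniteMeasure`).
A Lie group whose Haar measure is finite is compact, hence second countable. The family `τ` is norm
continuous, being weakly continuous with values of constant length
(`continuous_of_continuous_inner_of_unit`). All kernels are therefore continuous functions on a
compact second countable space, which gives integrability and Fubini's theorem. The bound for the
supremum follows by splitting the double integral along the diagonal
(`le_sSup_offDiag_of_le_integral`).
-/

/-! ### The Welch bound in a complex Euclidean space -/

section ScalarWelch

open scoped InnerProductSpace

variable {X : Type*} [MeasurableSpace X] {μ : Measure X}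

/-- With `S i j = ∫ v i * star (v j)`, the double integral on the right is `∑ i, ∑ j, ‖S i j‖ ^ 2`.
It dominates the diagonal part `∑ i, ‖S i i‖ ^ 2`, to which the Cauchy–Schwarz inequality for the
trace `∑ i, S i i = ∫ ∑ i, ‖v i‖ ^ 2` applies. -/
theorem sq_integral_sum_norm_sq_le [IsFiniteMeasure μ] {ι : Type*} [Fintype ι] (v : ι → X → ℂ)
    (hv : ∀ i, MemLp (v i) 2 μ) :
    (∫ x, ∑ i, ‖v i x‖ ^ 2 ∂μ) ^ 2 ≤
      Fintype.card ι * ∫ p : X × X, ‖∑ i, v i p.1 * star (v i p.2)‖ ^ 2 ∂(μ.prod μ) := by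
  set S : ι → ι → ℂ := fun i j => ∫ x, v i x * star (v j x) ∂μ with hS
  have hint : ∀ i j, Integrable (fun x => v i x * star (v j x)) μ := fun i j =>
    (hv i).integrable_mul (hv j).star
  have hdiag : ∀ i, S i i = ((∫ x, ‖v i x‖ ^ 2 ∂μ : ℝ) : ℂ) := by
    intro i
    rw [hS, ← integral_complex_ofReal]
    refine integral_congr_ae (.of_forall fun x => ?_)
    simp [Complex.mul_conj, Complex.normSq_eq_norm_sq]
  have hkey : ∫ p : X × X, ‖∑ i, v i p.1 * star (v i p.2)‖ ^ 2 ∂(μ.prod μ) =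
      ∑ i, ∑ j, ‖S i j‖ ^ 2 := by
    have h1 : ∀ p : X × X, ((‖∑ i, v i p.1 * star (v i p.2)‖ ^ 2 : ℝ) : ℂ) =
        ∑ i, ∑ j, (v i p.1 * star (v j p.1)) * (v j p.2 * star (v i p.2)) := by
      intro p
      rw [← Complex.normSq_eq_norm_sq, ← Complex.mul_conj, map_sum, Finset.sum_mul_sum]
      refine Finset.sum_congr rfl fun i _ => Finset.sum_congr rfl fun j _ => ?_
      simp
      ring
    have hprod : ∀ i j, Integrable
        (fun p : X × X => (v i p.1 * star (v j p.1)) * (v j p.2 * star (v i p.2))) (μ.prod μ) :=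
      fun i j => (hint i j).mul_prod (hint j i)
    have h2 : ∀ i j, S i j * S j i = ((‖S i j‖ ^ 2 : ℝ) : ℂ) := by
      intro i j
      have : S j i = star (S i j) := by
        simp only [hS, RCLike.star_def]
        rw [← integral_conj]
        refine integral_congr_ae (.of_forall fun x => ?_)
        simp [mul_comm]
      rw [this, RCLike.star_def, Complex.mul_conj, Complex.normSq_eq_norm_sq]
    apply Complex.ofReal_injective
    rw [← integral_complex_ofReal]
    simp_rw [h1]
    rw [integral_finsetSum _ fun i _ => integrable_finsetSum _ fun j _ => hprod i j]
    push_cast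
    refine Finset.sum_congr rfl fun i _ => ?_
    rw [integral_finsetSum _ fun j _ => hprod i j]
    refine Finset.sum_congr rfl fun j _ => ?_
    rw [integral_prod_mul (fun x => v i x * star (v j x)) (fun x => v j x * star (v i x))]
    exact_mod_cast h2 i j
  rw [hkey, integral_finsetSum _ fun i _ => (hv i).integrable_norm_pow two_ne_zero]
  refine sq_sum_le_card_mul_sum_sq.trans ?_
  rw [Finset.card_univ]
  gcongr with i
  refine le_trans (le_of_eq ?_) (Finset.single_le_sum (f := fun j => ‖S i j‖ ^ 2)
    (fun j _ => by positivity) (Finset.mem_univ i))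
  simp [hdiag i]

/-- The coordinate indexed by the multiset `s` of the `m`-th symmetric tensor power of `x`,
normalised so that inner products of tensor powers are powers of inner products. -/
noncomputable def symPowCoord {d m : ℕ} (s : Sym (Fin d) m) (x : EuclideanSpace ℂ (Fin d)) : ℂ :=
  (√(s.val.countPerms : ℝ) : ℂ) * (s.val.map x).prod

theorem continuous_symPowCoord {d m : ℕ} (s : Sym (Fin d) m) : Continuous (symPowCoord s) := by
  unfold symPowCoord
  refine continuous_const.mul (continuous_multiset_prod _ fun i _ => ?_)
  fun_prop

/-- This is the multinomial theorem for `(∑ i, x i * star (y i)) ^ m`. -/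
theorem sum_symPowCoord_mul_star {d m : ℕ} (x y : EuclideanSpace ℂ (Fin d)) :
    ∑ s : Sym (Fin d) m, symPowCoord s x * star (symPowCoord s y) = ⟪y, x⟫_ℂ ^ m := by
  rw [PiLp.inner_apply, Finset.sum_pow, Finset.sym_univ]
  refine Finset.sum_congr rfl fun s _ => ?_
  simp only [symPowCoord, RCLike.star_def, map_mul, Complex.conj_ofReal, RCLike.inner_apply,
    Multiset.prod_map_mul, map_multiset_prod, Multiset.map_map, Function.comp_def]
  have : ((√(s.val.countPerms : ℝ) : ℂ)) * (√(s.val.countPerms : ℝ) : ℂ) = s.val.countPerms := by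
    rw [← Complex.ofReal_mul, Real.mul_self_sqrt (by positivity)]
    simp
  rw [← this]
  ring

/-- The Welch bound for unit vectors in `ℂ^d`: apply `sq_integral_sum_norm_sq_le` to the
`(d + m - 1).choose m` coordinates of the symmetric tensor powers of the vectors. -/
theorem measureReal_sq_le_integral_norm_inner_pow [TopologicalSpace X] [CompactSpace X]
    [OpensMeasurableSpace X] [IsFiniteMeasure μ] {d : ℕ} (m : ℕ)
    {f : X → EuclideanSpace ℂ (Fin d)} (hf : Continuous f) (hf1 : ∀ x, ‖f x‖ = 1) :
    μ.real Set.univ ^ 2 ≤ ((d + m - 1).choose m : ℝ) *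
      ∫ p : X × X, ‖⟪f p.2, f p.1⟫_ℂ‖ ^ (2 * m) ∂(μ.prod μ) := by
  have h := sq_integral_sum_norm_sq_le (μ := μ) (fun (s : Sym (Fin d) m) x => symPowCoord s (f x))
    fun s => ((continuous_symPowCoord s).comp hf).memLp_of_hasCompactSupport
      (HasCompactSupport.of_compactSpace _)
  have hone : ∀ x, ∑ s : Sym (Fin d) m, ‖symPowCoord s (f x)‖ ^ 2 = 1 := by
    intro x
    apply Complex.ofReal_injective
    have := sum_symPowCoord_mul_star (m := m) (f x) (f x)
    rw [inner_self_eq_norm_sq_to_K, hf1] at this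
    simpa [Complex.mul_conj, Complex.normSq_eq_norm_sq] using this
  simp only [hone, sum_symPowCoord_mul_star, norm_pow, ← pow_mul, mul_comm m 2,
    Sym.card_sym_eq_choose, Fintype.card_fin] at h
  simpa using h

end ScalarWelch

/-! ### The supremum off the diagonal -/

section OffDiagonal

variable {X : Type*} [MeasurableSpace X] {μ : Measure X}

/-- A lower bound for the double integral of a kernel passes to its supremum off the diagonal: the
kernel is at most `1` on the diagonal, and at most the supremum off it. -/
theorem le_sSup_offDiag_of_le_integral [IsFiniteMeasure μ] {K : X → X → ℝ} (hK : ∀ g h, K g h ≤ 1)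
    (hint : Integrable (fun p : X × X => K p.1 p.2) (μ.prod μ)) {c : ℝ}
    (hc : c ≤ ∫ p : X × X, K p.1 p.2 ∂(μ.prod μ)) (hD : MeasurableSet (Set.diagonal X))
    (hne : (μ.prod μ) (Set.diagonal X)ᶜ ≠ 0) :
    BddAbove {r : ℝ | ∃ g h : X, g ≠ h ∧ r = K g h} ∧
    1 / (μ.prod μ).real (Set.diagonal X)ᶜ * (c - (μ.prod μ).real (Set.diagonal X)) ≤
      sSup {r : ℝ | ∃ g h : X, g ≠ h ∧ r = K g h} := by
  have hbdd : BddAbove {r : ℝ | ∃ g h : X, g ≠ h ∧ r = K g h} := by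
    refine ⟨1, ?_⟩
    rintro _ ⟨g, h, -, rfl⟩
    exact hK g h
  refine ⟨hbdd, ?_⟩
  have hpos : 0 < (μ.prod μ).real (Set.diagonal X)ᶜ :=
    ENNReal.toReal_pos hne (measure_ne_top _ _)
  rw [one_div_mul_eq_div, div_le_iff₀ hpos, sub_le_iff_le_add']
  refine hc.trans ?_
  rw [← integral_add_compl hD hint]
  gcongr
  · calc _ ≤ ∫ _ in Set.diagonal X, (1 : ℝ) ∂(μ.prod μ) :=
          integral_mono hint.integrableOn (integrable_const _) fun p => hK _ _
      _ = _ := by simp [Measure.real]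
  · calc _ ≤ ∫ _ in (Set.diagonal X)ᶜ, sSup {r : ℝ | ∃ g h : X, g ≠ h ∧ r = K g h} ∂(μ.prod μ) :=
          setIntegral_mono_on hint.integrableOn (integrable_const _) hD.compl
            fun p hp => le_csSup hbdd ⟨p.1, p.2, hp, rfl⟩
      _ = _ := by simp [Measure.real, mul_comm]

end OffDiagonal

/-! ### Characters and Hilbert C⋆-modules -/

section Characters

open scoped ComplexOrder InnerProductSpace MatrixOrder
open WeakDual

variable {A : Type*} [CommCStarAlgebra A]

theorem character_real_smul_one (χ : characterSpace ℂ A) (c : ℝ) : χ (c • (1 : A)) = c := by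
  rw [← Complex.coe_smul, map_smul, map_one, smul_eq_mul, mul_one]

theorem norm_character_apply_le (χ : characterSpace ℂ A) (a : A) : ‖χ a‖ ≤ ‖a‖ := by
  have : Nontrivial A := ⟨0, 1, fun h => by simpa using congrArg χ h⟩
  simpa using spectrum.norm_le_norm_mul_of_mem (AlgHom.apply_mem_spectrum χ a)

variable [PartialOrder A] {E : Type*} [NormedAddCommGroup E] [Module ℂ E] [Module A E]
  [CStarModule A E]

theorem continuous_of_inner_eq_character {d : ℕ} {χ : characterSpace ℂ A}
    {T : E →+ EuclideanSpace ℂ (Fin d)} (hT : ∀ x y, ⟪T x, T y⟫_ℂ = χ (inner A x y)) :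
    Continuous T := by
  refine AddMonoidHomClass.continuous_of_bound T 1 fun x => ?_
  rw [one_mul, ← sq_le_sq₀ (norm_nonneg _) (norm_nonneg _), CStarModule.norm_sq_eq A (x := x)]
  have h := norm_character_apply_le χ (inner A x x)
  rw [← hT, inner_self_eq_norm_sq_to_K] at h
  simpa using h

variable [StarOrderedRing A]

theorem character_nonneg (χ : characterSpace ℂ A) {a : A} (ha : 0 ≤ a) : 0 ≤ χ a := by
  obtain ⟨b, rfl⟩ := CStarAlgebra.nonneg_iff_eq_star_mul_self.mp ha
  rw [map_mul, map_star]
  exact star_mul_self_nonneg _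

/-- Positivity in a commutative C⋆-algebra is detected by characters: the Gelfand transform is
injective, and the values of the characters at `a` are its spectrum. -/
theorem nonneg_of_forall_character_nonneg {a : A} (h : ∀ χ : characterSpace ℂ A, 0 ≤ χ a) :
    0 ≤ a := by
  have hsa : IsSelfAdjoint a := by
    apply (gelfandTransform_bijective A).1
    ext χ
    change χ (star a) = χ a
    rw [map_star]
    exact (IsSelfAdjoint.of_nonneg (h χ)).star_eq
  rw [StarOrderedRing.nonneg_iff_spectrum_nonneg (R := ℝ) a hsa]
  intro r hr
  have hr' : (r : ℂ) ∈ spectrum ℂ a := by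
    rw [← hsa.spectrumRestricts.algebraMap_image]
    exact ⟨r, hr, rfl⟩
  obtain ⟨χ, hχ⟩ := CharacterSpace.mem_spectrum_iff_exists.mp hr'
  simpa [hχ] using h χ

theorem le_iff_forall_character_le {a b : A} :
    a ≤ b ↔ ∀ χ : characterSpace ℂ A, χ a ≤ χ b := by
  rw [← sub_nonneg]
  refine ⟨fun h χ => ?_, fun h => nonneg_of_forall_character_nonneg fun χ => ?_⟩
  · simpa using character_nonneg χ h
  · simpa using h χ

theorem le_of_real_smul_one_le [Nontrivial A] {c C : ℝ} (h : c • (1 : A) ≤ C • (1 : A)) :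
    c ≤ C := by
  obtain ⟨χ⟩ : Nonempty (characterSpace ℂ A) := inferInstance
  simpa [character_real_smul_one] using le_iff_forall_character_le.mp h χ

/-- A character `χ` turns the inner product of a module of rank `d` into a positive semidefinite
scalar form, which is the pullback of the inner product of `ℂ^d`. If `B⋆ B` is the Gram matrix of a
basis evaluated at `χ`, the map is `x ↦ B c`, where `c` is the coordinate vector of `x` evaluated at
`χ`. Complex scalars act on `E` through `algebraMap ℂ A`, because the given actions of `ℂ` and `A` on
`E` are not assumed to be compatible. -/
theorem exists_character_realization [Module.Finite A E] [Module.Free A E] {d : ℕ}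
    (hd : Module.finrank A E = d) (χ : characterSpace ℂ A) :
    ∃ T : E →+ EuclideanSpace ℂ (Fin d), (∀ (c : ℂ) x, T (algebraMap ℂ A c • x) = c • T x) ∧
      ∀ x y, ⟪T x, T y⟫_ℂ = χ (inner A x y) := by
  have : Nontrivial A := ⟨0, 1, fun h => by simpa using congrArg χ h⟩
  let e : Module.Basis (Fin d) A E := Module.finBasisOfFinrankEq A E hd
  let M : Matrix (Fin d) (Fin d) ℂ := .of fun i j => χ (inner A (e i) (e j))
  have hinner : ∀ x y : E, χ (inner A x y) =
      star (fun i => χ (e.repr x i)) ⬝ᵥ M.mulVec (fun i => χ (e.repr y i)) := by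
    intro x y
    conv_lhs => rw [← e.sum_repr x, ← e.sum_repr y]
    simp only [CStarModule.inner_sum_left, CStarModule.inner_sum_right,
      CStarModule.inner_op_smul_left, CStarModule.inner_op_smul_right, map_sum, map_mul, map_star,
      dotProduct, Matrix.mulVec, Finset.mul_sum, Pi.star_apply, M, Matrix.of_apply]
    rw [Finset.sum_comm]
    refine Finset.sum_congr rfl fun i _ => Finset.sum_congr rfl fun j _ => ?_
    ring
  have hM : M.PosSemidef := by
    refine Matrix.PosSemidef.of_dotProduct_mulVec_nonneg ?_ fun v => ?_
    · ext i j
      simp [M, Matrix.conjTranspose_apply, ← map_star]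
    · have h := hinner (∑ i, algebraMap ℂ A (v i) • e i) (∑ i, algebraMap ℂ A (v i) • e i)
      have hv : (fun i => χ (e.repr (∑ i, algebraMap ℂ A (v i) • e i) i)) = v := by
        ext i
        rw [e.repr_sum_self]
        simp [AlgHomClass.commutes]
      rw [hv] at h
      rw [← h]
      exact character_nonneg χ CStarModule.inner_self_nonneg
  obtain ⟨B, hB⟩ := CStarAlgebra.nonneg_iff_eq_star_mul_self.mp hM.nonneg
  refine ⟨.mk' (fun x => WithLp.toLp 2 (B.mulVec fun i => χ (e.repr x i))) fun x y => ?_,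
    fun c x => ?_, fun x y => ?_⟩
  · rw [← WithLp.toLp_add, ← Matrix.mulVec_add]
    refine congrArg (WithLp.toLp 2) ?_
    refine congrArg B.mulVec (funext fun i => ?_)
    simp
  · change WithLp.toLp 2 _ = c • WithLp.toLp 2 _
    rw [← WithLp.toLp_smul, ← Matrix.mulVec_smul]
    refine congrArg (WithLp.toLp 2) ?_
    refine congrArg B.mulVec (funext fun i => ?_)
    simp
  · change ⟪WithLp.toLp 2 _, WithLp.toLp 2 _⟫_ℂ = _
    rw [hinner, hB, EuclideanSpace.inner_toLp_toLp, dotProduct_comm, Matrix.star_mulVec,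
      Matrix.star_eq_conjTranspose, ← Matrix.mulVec_mulVec, ← Matrix.dotProduct_mulVec]

/-- Parseval's identity at a character: the vectors `u i` are lifts to `E` of an orthonormal basis of
the image of `E` in `ℂ^d`. -/
theorem exists_sum_character_inner_mul_inner [Module.Finite A E] [Module.Free A E]
    (χ : characterSpace ℂ A) :
    ∃ (k : ℕ) (u : Fin k → E), ∀ x : E,
      ∑ i, χ (inner A x (u i) * inner A (u i) x) = χ (inner A x x) := by
  obtain ⟨T, hsmul, hT⟩ := exists_character_realization (E := E) rfl χ
  let W : Submodule ℂ (EuclideanSpace ℂ (Fin (Module.finrank A E))) :=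
    { carrier := Set.range T
      add_mem' := by
        rintro _ _ ⟨x, rfl⟩ ⟨y, rfl⟩
        exact ⟨x + y, map_add T x y⟩
      zero_mem' := ⟨0, map_zero T⟩
      smul_mem' := by
        rintro c _ ⟨x, rfl⟩
        exact ⟨_, hsmul c x⟩ }
  let b := stdOrthonormalBasis ℂ W
  choose u hu using fun i => (b i).2
  refine ⟨_, u, fun x => ?_⟩
  have h := b.sum_inner_mul_inner ⟨T x, x, rfl⟩ ⟨T x, x, rfl⟩
  simp only [Submodule.coe_inner] at h
  simpa only [← hu, hT, ← map_mul] using h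

end Characters

/-! ### Families of unit vectors in a Hilbert C⋆-module -/

section ModularFrames

open scoped ComplexOrder InnerProductSpace
open WeakDual

variable {A : Type*} [CommCStarAlgebra A] [PartialOrder A]
  {E : Type*} [NormedAddCommGroup E] [Module ℂ E] [Module A E] [CStarModule A E]
  {G : Type*}

/-- For unit vectors `‖x - y‖² = ‖2 - ⟨x, y⟩ - ⟨y, x⟩‖`, so weak continuity gives norm
continuity. -/
theorem continuous_of_continuous_inner_of_unit [TopologicalSpace G] {τ : G → E}
    (hτ : ∀ x : E, Continuous fun g => (inner A (τ g) x : A))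
    (hunit : ∀ g, inner A (τ g) (τ g) = (1 : A)) : Continuous τ := by
  refine continuous_iff_continuousAt.2 fun g₀ => ?_
  rw [ContinuousAt, tendsto_iff_norm_sub_tendsto_zero]
  have hsq : ∀ g, ‖τ g - τ g₀‖ =
      √‖(1 - star (inner A (τ g) (τ g₀)) - (inner A (τ g) (τ g₀) - 1) : A)‖ := by
    intro g
    rw [CStarModule.norm_eq_sqrt_norm_inner_self (A := A)]
    simp only [CStarModule.inner_sub_left, CStarModule.inner_sub_right, hunit,
      CStarModule.star_inner]
  have hc : Continuous fun g =>
      √‖(1 - star (inner A (τ g) (τ g₀)) - (inner A (τ g) (τ g₀) - 1) : A)‖ := by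
    have := hτ (τ g₀)
    fun_prop
  simp_rw [hsq]
  have h := hc.tendsto g₀
  simpa [hunit] using h

variable [StarOrderedRing A]

theorem CStarModule.continuous_inner_comp {X : Type*} [TopologicalSpace X] {f g : X → E}
    (hf : Continuous f) (hg : Continuous g) : Continuous fun x => (inner A (f x) (g x) : A) :=
  letI : NormedSpace ℂ E := .ofCore (CStarModule.normedSpaceCore A)
  CStarModule.continuous_inner.comp (hf.prodMk hg)

theorem norm_inner_le_one_of_unit {x y : E} (hx : inner A x x = (1 : A))
    (hy : inner A y y = (1 : A)) : ‖(inner A x y : A)‖ ≤ 1 := by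
  have key : ∀ z : E, inner A z z = (1 : A) → ‖z‖ ≤ 1 := by
    intro z hz
    rw [← sq_le_one_iff₀ (norm_nonneg z), CStarModule.norm_sq_eq A, hz]
    nontriviality A
    exact CStarRing.norm_one.le
  calc _ ≤ ‖x‖ * ‖y‖ := CStarModule.norm_inner_le E
    _ ≤ 1 := mul_le_one₀ (key x hx) (norm_nonneg y) (key y hy)

/-- At a character, `⟨τ g, τ g⟩ = 1` is a finite sum of the integrable coefficients
`⟨u, τ g⟩ ⟨τ g, u⟩`, so the constant `1` is integrable. -/
theorem IsContinuousModularBessel.isFiniteMeasure [Nontrivial A] [Module.Finite A E]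
    [Module.Free A E] [TopologicalSpace G] [MeasurableSpace G] {μ : Measure G} {τ : G → E}
    (hτ : IsContinuousModularBessel A μ τ) (hunit : ∀ g, inner A (τ g) (τ g) = (1 : A)) :
    IsFiniteMeasure μ := by
  obtain ⟨χ⟩ : Nonempty (characterSpace ℂ A) := inferInstance
  obtain ⟨k, u, hu⟩ := exists_sum_character_inner_mul_inner (E := E) χ
  obtain ⟨b, -, hb⟩ := hτ.bessel
  have h : Integrable (fun g => ∑ i, χ (inner A (τ g) (u i) * inner A (u i) (τ g))) μ :=
    integrable_finsetSum _ fun i _ =>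
      (CharacterSpace.toCLM χ).integrable_comp (hb (u i)).1
  simp only [hu, hunit, map_one] at h
  exact (integrable_const_iff_isFiniteMeasure one_ne_zero).mp h

theorem mul_swap_pow_le_norm_pow_smul_one (x y : E) (m : ℕ) :
    inner A y x ^ m * inner A x y ^ m ≤ ‖(inner A y x : A)‖ ^ (2 * m) • (1 : A) := by
  refine le_iff_forall_character_le.mpr fun χ => ?_
  rw [character_real_smul_one, ← CStarModule.star_inner y x, map_mul, map_pow, map_pow, map_star,
    ← mul_pow, RCLike.star_def, Complex.mul_conj, Complex.normSq_eq_norm_sq, pow_mul]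
  have := norm_character_apply_le χ (inner A y x)
  exact_mod_cast pow_le_pow_left₀ (by positivity) (pow_le_pow_left₀ (norm_nonneg _) this 2) m

variable [TopologicalSpace G] [CompactSpace G] [SecondCountableTopology G] [MeasurableSpace G]
  [BorelSpace G] {μ : Measure G} [IsFiniteMeasure μ]

theorem integrable_inner_pow_mul_inner_pow {τ : G → E} (hτ : Continuous τ) (m : ℕ) :
    Integrable (fun p : G × G =>
      (inner A (τ p.2) (τ p.1) ^ m * inner A (τ p.1) (τ p.2) ^ m : A)) (μ.prod μ) := by
  have h₁ : Continuous fun p : G × G => (inner A (τ p.2) (τ p.1) : A) :=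
    CStarModule.continuous_inner_comp (by fun_prop) (by fun_prop)
  have h₂ : Continuous fun p : G × G => (inner A (τ p.1) (τ p.2) : A) :=
    CStarModule.continuous_inner_comp (by fun_prop) (by fun_prop)
  exact ((h₁.pow m).mul (h₂.pow m)).integrable_of_hasCompactSupport
    (HasCompactSupport.of_compactSpace _)

theorem integrable_norm_inner_pow {τ : G → E} (hτ : Continuous τ) (m : ℕ) :
    Integrable (fun p : G × G => ‖(inner A (τ p.2) (τ p.1) : A)‖ ^ (2 * m)) (μ.prod μ) := by
  have h₁ : Continuous fun p : G × G => (inner A (τ p.2) (τ p.1) : A) :=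
    CStarModule.continuous_inner_comp (by fun_prop) (by fun_prop)
  exact (h₁.norm.pow _).integrable_of_hasCompactSupport (HasCompactSupport.of_compactSpace _)

/-- The Welch bound in the order of the algebra, obtained from the bound in `ℂ^d` at each
character. -/
theorem welch_le_integral_inner_pow [Module.Finite A E] [Module.Free A E] {d : ℕ}
    (hd : Module.finrank A E = d) {τ : G → E} (hτ : Continuous τ)
    (hunit : ∀ g, inner A (τ g) (τ g) = (1 : A)) (m : ℕ) :
    (μ.real Set.univ ^ 2 / ((d + m - 1).choose m : ℝ)) • (1 : A) ≤
      ∫ p : G × G, inner A (τ p.2) (τ p.1) ^ m * inner A (τ p.1) (τ p.2) ^ m ∂(μ.prod μ) := by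
  refine le_iff_forall_character_le.mpr fun χ => ?_
  obtain ⟨T, -, hT⟩ := exists_character_realization hd χ
  have hone : ∀ g, ‖T (τ g)‖ = 1 := by
    intro g
    rw [← sq_eq_sq₀ (norm_nonneg _) zero_le_one]
    apply Complex.ofReal_injective
    have := hT (τ g) (τ g)
    rw [inner_self_eq_norm_sq_to_K, hunit, map_one] at this
    simpa using this
  have hcont : Continuous fun g => T (τ g) :=
    (continuous_of_inner_eq_character hT).comp hτ
  have hint : χ (∫ p : G × G, inner A (τ p.2) (τ p.1) ^ m * inner A (τ p.1) (τ p.2) ^ m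
      ∂(μ.prod μ)) = ((∫ p : G × G, ‖⟪T (τ p.2), T (τ p.1)⟫_ℂ‖ ^ (2 * m) ∂(μ.prod μ) : ℝ) : ℂ) := by
    rw [← integral_complex_ofReal]
    refine ((CharacterSpace.toCLM χ).integral_comp_comm
      (integrable_inner_pow_mul_inner_pow hτ m)).symm.trans ?_
    refine integral_congr_ae (.of_forall fun p => ?_)
    change χ _ = _
    dsimp only
    rw [← CStarModule.star_inner (τ p.2) (τ p.1), map_mul, map_pow, map_pow, map_star, ← mul_pow,
      RCLike.star_def, Complex.mul_conj, Complex.normSq_eq_norm_sq, hT, pow_mul]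
    push_cast
    rfl
  rw [character_real_smul_one, hint, Complex.real_le_real]
  have h := measureReal_sq_le_integral_norm_inner_pow (μ := μ) m hcont hone
  exact div_le_of_le_mul₀ (by positivity) (integral_nonneg fun _ => by positivity)
    (by rwa [mul_comm])

end ModularFrames

/-! ### Modular Welch bounds on a Lie group -/

theorem mainTheorem3
    -- the algebra: nonzero commutative, and a σ-finite W⋆-algebra or an AW⋆-algebra
    {A : Type*} [CommCStarAlgebra A] [Nontrivial A] [PartialOrder A] [StarOrderedRing A]
    (hA : (WStarAlgebra A ∧ IsSigmaFiniteCStar A) ∨ IsAWStarAlgebra A)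
    -- the (complete) Hilbert C⋆-module, of rank d
    {E : Type*} [NormedAddCommGroup E] [CompleteSpace E] [Module ℂ E] [Module A E]
    [CStarModule A E] [Module.Finite A E] [Module.Free A E]
    (d : ℕ) (hd : Module.finrank A E = d)
    -- the Lie group, with a left Haar measure
    {V : Type*} [NormedAddCommGroup V] [NormedSpace ℝ V] [FiniteDimensional ℝ V]
    {G : Type*} [Group G] [TopologicalSpace G] [T2Space G] [ChartedSpace V G]
    [LieGroup 𝓘(ℝ, V) ∞ G]
    [MeasurableSpace G] [BorelSpace G] (μ : Measure G) [μ.IsHaarMeasure]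
    -- the unit inner product Bessel family; `⟨x, y⟩` is `inner A y x`
    (τ : G → E) (hτ : IsContinuousModularBessel A μ τ)
    (hunit : ∀ g : G, inner A (τ g) (τ g) = (1 : A)) :
    μ Set.univ < ⊤ ∧
    (∀ m : ℕ,
      Integrable (fun p : G × G => ‖inner A (τ p.2) (τ p.1)‖ ^ (2 * m)) (μ.prod μ) ∧
      Integrable (fun p : G × G =>
        inner A (τ p.2) (τ p.1) ^ m * inner A (τ p.1) (τ p.2) ^ m) (μ.prod μ) ∧
      ∫ p : G × G, ‖inner A (τ p.2) (τ p.1)‖ ^ (2 * m) ∂(μ.prod μ) =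
        ∫ h, ∫ g, ‖inner A (τ h) (τ g)‖ ^ (2 * m) ∂μ ∂μ ∧
      ∫ p : G × G, inner A (τ p.2) (τ p.1) ^ m * inner A (τ p.1) (τ p.2) ^ m ∂(μ.prod μ) ≤
        (∫ h, ∫ g, ‖inner A (τ h) (τ g)‖ ^ (2 * m) ∂μ ∂μ) • (1 : A) ∧
      ∫ p : G × G, inner A (τ p.2) (τ p.1) ^ m * inner A (τ p.1) (τ p.2) ^ m ∂(μ.prod μ) =
        ∫ h, ∫ g, inner A (τ h) (τ g) ^ m * inner A (τ g) (τ h) ^ m ∂μ ∂μ ∧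
      (μ.real Set.univ ^ 2 / ((d + m - 1).choose m : ℝ)) • (1 : A) ≤
        ∫ h, ∫ g, inner A (τ h) (τ g) ^ m * inner A (τ g) (τ h) ^ m ∂μ ∂μ) ∧
    -- the first order case
    (∫ p : G × G, ‖inner A (τ p.2) (τ p.1)‖ ^ 2 ∂(μ.prod μ) =
        ∫ h, ∫ g, ‖inner A (τ h) (τ g)‖ ^ 2 ∂μ ∂μ ∧
      ∫ p : G × G, inner A (τ p.2) (τ p.1) * inner A (τ p.1) (τ p.2) ∂(μ.prod μ) ≤
        (∫ h, ∫ g, ‖inner A (τ h) (τ g)‖ ^ 2 ∂μ ∂μ) • (1 : A) ∧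
      ∫ p : G × G, inner A (τ p.2) (τ p.1) * inner A (τ p.1) (τ p.2) ∂(μ.prod μ) =
        ∫ h, ∫ g, inner A (τ h) (τ g) * inner A (τ g) (τ h) ∂μ ∂μ ∧
      (μ.real Set.univ ^ 2 / (d : ℝ)) • (1 : A) ≤
        ∫ h, ∫ g, inner A (τ h) (τ g) * inner A (τ g) (τ h) ∂μ ∂μ) ∧
    -- the bounds for the supremum off the diagonal
    (MeasurableSet (Set.diagonal G) → (μ.prod μ) (Set.diagonal G)ᶜ ≠ 0 →
      (∀ m : ℕ,
        BddAbove {r : ℝ | ∃ g h : G, g ≠ h ∧ r = ‖inner A (τ h) (τ g)‖ ^ (2 * m)} ∧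
        1 / (μ.prod μ).real (Set.diagonal G)ᶜ *
            (μ.real Set.univ ^ 2 / ((d + m - 1).choose m : ℝ) -
              (μ.prod μ).real (Set.diagonal G)) ≤
          sSup {r : ℝ | ∃ g h : G, g ≠ h ∧ r = ‖inner A (τ h) (τ g)‖ ^ (2 * m)}) ∧
      1 / (μ.prod μ).real (Set.diagonal G)ᶜ *
          (μ.real Set.univ ^ 2 / (d : ℝ) - (μ.prod μ).real (Set.diagonal G)) ≤
        sSup {r : ℝ | ∃ g h : G, g ≠ h ∧ r = ‖inner A (τ h) (τ g)‖ ^ 2}) := by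
  have hτint := hτ.isFiniteMeasure hunit
  have hgrp : IsTopologicalGroup G := topologicalGroup_of_lieGroup 𝓘(ℝ, V) ∞
  have hloc : LocallyCompactSpace G := ChartedSpace.locallyCompactSpace V G
  -- A noncompact locally compact group has infinite Haar measure.
  have hcpt : CompactSpace G := by
    by_contra hnc
    have : NoncompactSpace G := not_compactSpace_iff.mp hnc
    exact measure_ne_top μ Set.univ (measure_univ_of_isMulLeftInvariant μ)
  have hsc : SecondCountableTopology G := ChartedSpace.secondCountable_of_sigmaCompact V G
  have hcont : Continuous τ := continuous_of_continuous_inner_of_unit hτ.continuous_inner hunit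
  have hI := integrable_inner_pow_mul_inner_pow (A := A) (μ := μ) hcont
  have hN := integrable_norm_inner_pow (A := A) (μ := μ) hcont
  have hW := welch_le_integral_inner_pow (μ := μ) hd hcont hunit
  have hle : ∀ m : ℕ,
      ∫ p : G × G, inner A (τ p.2) (τ p.1) ^ m * inner A (τ p.1) (τ p.2) ^ m ∂(μ.prod μ) ≤
        (∫ p : G × G, ‖inner A (τ p.2) (τ p.1)‖ ^ (2 * m) ∂(μ.prod μ)) • (1 : A) := by
    intro m
    rw [← integral_smul_const]
    exact integral_mono (hI m) ((hN m).smul_const _)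
      fun p => mul_swap_pow_le_norm_pow_smul_one _ _ m
  have hmain := fun m : ℕ => And.intro (hN m) <| And.intro (hI m) <|
    And.intro (integral_prod_symm _ (hN m)) <|
    And.intro ((hle m).trans_eq (by rw [integral_prod_symm _ (hN m)])) <|
    And.intro (integral_prod_symm _ (hI m)) <|
    (hW m).trans_eq (integral_prod_symm _ (hI m))
  have hsup := fun hD hne (m : ℕ) => le_sSup_offDiag_of_le_integral (μ := μ)
    (K := fun g h => ‖inner A (τ h) (τ g)‖ ^ (2 * m))
    (fun g h => pow_le_one₀ (norm_nonneg _) (norm_inner_le_one_of_unit (hunit h) (hunit g)))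
    (hN m) (le_of_real_smul_one_le ((hW m).trans (hle m))) hD hne
  refine ⟨measure_lt_top μ _, hmain, ?_, fun hD hne => ⟨hsup hD hne, ?_⟩⟩
  · simpa using (hmain 1).2.2
  · simpa using (hsup hD hne 1).2
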